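/- A finite set of points in the plane is in general position if no three of its points are collinear, and in convex position if none of its points lies in the convex hull of the others. For an integer $n\ge 3$ let $ES(n)$ be the least integer $N$ such that every set of at least $N$ points in general position in the plane contains $n$ points in convex position (that is, the vertices of a convex $n$-gon). Then $$\limsup_{n\to\infty}\frac{ES(n)}{\binom{2n-5}{n-2}}\le\frac78 .$$ -/

import Mathlib

/-- The Euclidean plane. -/
abbrev Plane : Type := EuclideanSpace ℝ (Fin 2)

/-- A finite set of points of the plane is in general position if no three distinct points of it
lie on a line. -/
def InGeneralPosition (P : Finset Plane) : Prop :=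
  ∀ a ∈ P, ∀ b ∈ P, ∀ c ∈ P, a ≠ b → a ≠ c → b ≠ c → ¬ Collinear ℝ ({a, b, c} : Set Plane)

/-- A finite set of points of the plane is in convex position if no point of it lies in the convex
hull of the others; for `n ≥ 3` points this says that they are the vertices of a convex `n`-gon. -/
def InConvexPosition (Q : Finset Plane) : Prop :=
  ConvexIndependent ℝ (Subtype.val : ↥(Q : Set Plane) → Plane)

/-- `ForcesConvex n N`: every set of at least `N` points in general position in the plane
contains `n` points in convex position. -/
def ForcesConvex (n N : ℕ) : Prop :=
  ∀ P : Finset Plane, N ≤ P.card → InGeneralPosition P →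
    ∃ Q : Finset Plane, Q ⊆ P ∧ Q.card = n ∧ InConvexPosition Q

/-- The Erdős–Szekeres number: the smallest `N` such that every set of at least `N` points in
general position in the plane contains `n` points in convex position. The value is `⊤` if there is
no such `N`, so that every upper bound on it includes the existence of such an `N`. -/
noncomputable def ES (n : ℕ) : ℕ∞ :=
  ⨅ (N : ℕ) (_ : ForcesConvex n N), (N : ℕ∞)

/-! The proof gives an exponentially stronger bound: up to a constant factor, `8 * j` points in
convex position are forced by `48000 ^ j` points, whereas `(2n-5).choose (n-2)` grows like `65536 ^
(n / 8)` up to a polynomial factor, since `4 ^ 8 = 65536`. The quotient therefore tends to zero, and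
`7/8` is reached with room to spare.

A positive-fraction cups-caps theorem (`exists_positive_fraction`) yields 48 families, all of whose
transversals are cups or all caps; every third family is large. They form eight blocks of six. In a
block, the outer families supply base points `ℓ` and `r`, and two large families lie between them.
Order each large family by `InTriangle`. Mirsky's theorem gives a long chain or a long antichain.

If both large families of some block have long chains, cups-caps inside each, sorted by height over
`ℓ r`, gives a convex polygon outright or one half of a polygon in each family; the two halves fit
together (`inConvexPosition_union`). Otherwise every block has a long antichain. Cups-caps there
gives either a large polygon bending the wrong way, or a short chain bending with the families.
Incomparability makes the short chain convex together with `ℓ` and `r`, so the eight short chains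
merge (`isTripleChain_biUnion`). Each needs only `j + 2` points, which makes the asymmetric binomial
`(j + 8 * j).choose j` small. -/

/-! ### Orientation, convex position and affine forms. -/

/-- `ε` times twice the signed area of the triangle `p q r`. -/
noncomputable def orient (ε : ℝ) (p q r : Plane) : ℝ :=
  ε * ((q 0 - p 0) * (r 1 - p 1) - (q 1 - p 1) * (r 0 - p 0))

lemma orient_rotate (ε : ℝ) (p q r : Plane) : orient ε p q r = orient ε q r p := by
  unfold orient; ring

lemma orient_swap (ε : ℝ) (p q r : Plane) : orient ε q p r = -orient ε p q r := by
  unfold orient; ring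

lemma orient_neg (ε : ℝ) (p q r : Plane) : orient (-ε) p q r = -orient ε p q r := by
  unfold orient; ring

lemma InGeneralPosition.orient_ne_zero {P : Finset Plane} (hP : InGeneralPosition P) {ε : ℝ}
    (hε : ε ≠ 0) {p q r : Plane} (hp : p ∈ P) (hq : q ∈ P) (hr : r ∈ P)
    (hpq : p ≠ q) (hpr : p ≠ r) (hqr : q ≠ r) : orient ε p q r ≠ 0 := by
  intro h
  refine hP p hp q hq r hr hpq hpr hqr ?_
  have h0 : (q 0 - p 0) * (r 1 - p 1) - (q 1 - p 1) * (r 0 - p 0) = 0 := by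
    rcases mul_eq_zero.mp h with h | h
    · exact absurd h hε
    · exact h
  rw [collinear_iff_of_mem (p₀ := p) (by simp)]
  refine ⟨q - p, ?_⟩
  have key : ∃ t : ℝ, r = t • (q - p) + p := by
    by_cases hx : q 0 - p 0 = 0
    · have hy : q 1 - p 1 ≠ 0 := by
        intro hy
        apply hpq
        ext i
        fin_cases i
        · simp; linarith
        · simp; linarith
      refine ⟨(r 1 - p 1) / (q 1 - p 1), ?_⟩
      have : r 0 - p 0 = 0 := by
        rw [hx] at h0
        have : (q 1 - p 1) * (r 0 - p 0) = 0 := by linarith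
        exact (mul_eq_zero.mp this).resolve_left hy
      ext i
      fin_cases i
      · simp [hx]; linarith
      · simp; field_simp; ring
    · refine ⟨(r 0 - p 0) / (q 0 - p 0), ?_⟩
      ext i
      fin_cases i
      · simp; field_simp; ring
      · simp; field_simp; linarith
  intro s hs
  simp only [Set.mem_insert_iff, Set.mem_singleton_iff] at hs
  rcases hs with rfl | rfl | rfl
  · exact ⟨0, by simp⟩
  · exact ⟨1, by simp⟩
  · simpa using key

/-- All triples of `C` listed in increasing order of `φ` satisfy `T`. -/
def IsTripleChain {α : Type*} (φ : α → ℝ) (T : α → α → α → Prop) (C : Finset α) : Prop :=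
  ∀ p ∈ C, ∀ q ∈ C, ∀ r ∈ C, φ p < φ q → φ q < φ r → T p q r

/-- An open half-plane bounded by the line `p q`, together with `q`, is convex. -/
lemma convex_insert_halfPlane (ε : ℝ) (p q : Plane) :
    Convex ℝ (insert q {z : Plane | 0 < orient ε p q z}) := by
  have aff : ∀ (x y : Plane) (a b : ℝ), a + b = 1 →
      orient ε p q (a • x + b • y) = a * orient ε p q x + b * orient ε p q y := by
    intro x y a b hab
    obtain rfl : a = 1 - b := by linarith
    simp [orient]; ring
  have hq : orient ε p q q = 0 := by unfold orient; ring
  intro x hx y hy a b ha hb hab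
  rcases ha.eq_or_lt with rfl | ha
  · obtain rfl : b = 1 := by linarith
    simpa using hy
  rcases hb.eq_or_lt with rfl | hb
  · obtain rfl : a = 1 := by linarith
    simpa using hx
  rcases hx with rfl | hx
  · rcases hy with rfl | hy
    · left; rw [← add_smul, hab, one_smul]
    · right
      have hy' : 0 < orient ε p x y := hy
      simp only [Set.mem_ofPred_eq]
      rw [aff _ _ _ _ hab, hq]; positivity
  · have hx' : 0 < orient ε p q x := hx
    right
    simp only [Set.mem_ofPred_eq]
    rw [aff _ _ _ _ hab]
    rcases hy with rfl | hy
    · rw [hq]; positivity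
    · have hy' : 0 < orient ε p q y := hy
      positivity

/-- A set of points is in convex position if it can be listed so that all triples have the same
orientation. -/
lemma inConvexPosition_of_isTripleChain {Q : Finset Plane} {κ : Plane → ℝ} {ε : ℝ}
    (hκ : Set.InjOn κ Q) (hcard : 2 ≤ Q.card)
    (h : IsTripleChain κ (fun p q r => 0 < orient ε p q r) Q) : InConvexPosition Q := by
  rw [InConvexPosition, convexIndependent_set_iff_notMem_convexHull_sdiff]
  intro p hp hmem
  have hp' : p ∈ Q := hp
  -- Here `q` is the cyclic successor of `p` in the order of `κ`. All other points lie strictly on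
  -- one side of the line `p q`, so their hull together with `q` misses `p`.
  obtain ⟨q, hq, hqp, hpos⟩ : ∃ q ∈ Q, q ≠ p ∧
      ∀ z ∈ Q, z ≠ p → z ≠ q → 0 < orient ε p q z := by
    by_cases hmax : (Q.filter fun z => κ p < κ z).Nonempty
    · obtain ⟨q, hq, hmin⟩ := Finset.exists_min_image _ κ hmax
      rw [Finset.mem_filter] at hq
      refine ⟨q, hq.1, fun e => by simp [e] at hq, fun z hz hzp hzq => ?_⟩
      rcases lt_or_gt_of_ne (fun e => hzp (hκ hz hp e)) with hlt | hgt
      · rw [← orient_rotate]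
        exact h z hz p hp q hq.1 hlt hq.2
      · refine h p hp q hq.1 z hz hq.2 (lt_of_le_of_ne (hmin z ?_) fun e => hzq (hκ hz hq.1 e.symm))
        rw [Finset.mem_filter]; exact ⟨hz, hgt⟩
    · rw [Finset.not_nonempty_iff_eq_empty, Finset.filter_eq_empty_iff] at hmax
      have hne : (Q.erase p).Nonempty := by
        rw [← Finset.card_pos, Finset.card_erase_of_mem hp']; omega
      obtain ⟨q, hq, hmin⟩ := Finset.exists_min_image _ κ hne
      rw [Finset.mem_erase] at hq
      refine ⟨q, hq.2, hq.1, fun z hz hzp hzq => ?_⟩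
      rw [orient_rotate]
      refine h q hq.2 z hz p hp (lt_of_le_of_ne (hmin z ?_) fun e => hzq (hκ hz hq.2 e.symm))
        (lt_of_le_of_ne (not_lt.mp (hmax hz)) fun e => hzp (hκ hz hp e))
      rw [Finset.mem_erase]; exact ⟨hzp, hz⟩
  have hsub : (↑Q \ {p} : Set Plane) ⊆ insert q {z : Plane | 0 < orient ε p q z} := by
    intro z hz
    by_cases hzq : z = q
    · exact Or.inl hzq
    · exact Or.inr (hpos z hz.1 hz.2 hzq)
  rcases convexHull_min hsub (convex_insert_halfPlane ε p q) hmem with e | hlt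
  · exact hqp e.symm
  · have h0 : orient ε p q p = 0 := by unfold orient; ring
    have hlt' : 0 < orient ε p q p := hlt
    linarith

lemma InConvexPosition.mono {Q R : Finset Plane} (hR : InConvexPosition R) (h : Q ⊆ R) :
    InConvexPosition Q :=
  ConvexIndependent.mono hR (by exact_mod_cast h)

/-- A real-valued affine function on the plane. -/
def IsAffineForm (φ : Plane → ℝ) : Prop :=
  ∃ α β γ : ℝ, ∀ p, φ p = α * p 0 + β * p 1 + γ

/-- The four orientations satisfy linear relations whose coefficients are differences of `φ`,
positive by the ordering. This is the only geometric input to cups-caps, and it works for any affine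
sorting function. -/
lemma IsAffineForm.orient_trans {φ : Plane → ℝ} (hφ : IsAffineForm φ) {ε : ℝ} {p q r s : Plane}
    (hpq : φ p < φ q) (hqr : φ q < φ r) (hrs : φ r < φ s)
    (h₁ : 0 < orient ε p q r) (h₂ : 0 < orient ε q r s) :
    0 < orient ε p q s ∧ 0 < orient ε p r s := by
  obtain ⟨α, β, γ, h⟩ := hφ
  have e₁ : (φ r - φ q) * orient ε p q s =
      (φ s - φ q) * orient ε p q r + (φ q - φ p) * orient ε q r s := by
    simp only [h, orient]; ring
  have e₂ : (φ r - φ q) * orient ε p r s =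
      (φ r - φ p) * orient ε q r s + (φ s - φ r) * orient ε p q r := by
    simp only [h, orient]; ring
  have hpos : 0 < φ r - φ q := by linarith
  constructor
  · refine pos_of_mul_pos_right (a := φ r - φ q) ?_ hpos.le
    rw [e₁]
    exact add_pos (mul_pos (by linarith) h₁) (mul_pos (by linarith) h₂)
  · refine pos_of_mul_pos_right (a := φ r - φ q) ?_ hpos.le
    rw [e₂]
    exact add_pos (mul_pos (by linarith) h₂) (mul_pos (by linarith) h₁)

/-- Every finite set of points is separated by some affine form. -/
lemma exists_isAffineForm_injOn (P : Finset Plane) :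
    ∃ φ : Plane → ℝ, IsAffineForm φ ∧ Set.InjOn φ P := by
  obtain ⟨t, ht⟩ := Set.Infinite.exists_notMem_finset (Set.infinite_univ (α := ℝ))
    ((P ×ˢ P).image fun x => -(x.1 0 - x.2 0) / (x.1 1 - x.2 1))
  refine ⟨fun p => 1 * p 0 + t * p 1 + 0, ⟨1, t, 0, fun _ => rfl⟩, fun p hp q hq e => ?_⟩
  simp only [one_mul, add_zero] at e
  have hy : p 1 = q 1 := by
    by_contra hne
    refine ht.2 (Finset.mem_image.mpr ⟨(p, q), Finset.mem_product.mpr ⟨hp, hq⟩, ?_⟩)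
    have : p 1 - q 1 ≠ 0 := sub_ne_zero.mpr hne
    simp only
    field_simp
    linarith
  have hx : p 0 = q 0 := by rw [hy] at e; linarith
  ext i
  fin_cases i
  · exact hx
  · exact hy

/-! ### Abstract cups-caps theorem. -/

/-- Transitivity of a ternary relation on `S`, sorted by `φ`. -/
def TripleTransOn {α : Type*} (φ : α → ℝ) (T : α → α → α → Prop) (S : Finset α) : Prop :=
  ∀ p ∈ S, ∀ q ∈ S, ∀ r ∈ S, ∀ s ∈ S, φ p < φ q → φ q < φ r → φ r < φ s →
    T p q r → T q r s → T p q s ∧ T p r s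

lemma TripleTransOn.mono {α : Type*} {φ : α → ℝ} {T : α → α → α → Prop} {S S' : Finset α}
    (h : TripleTransOn φ T S') (hs : S ⊆ S') : TripleTransOn φ T S :=
  fun p hp q hq r hr s hs' => h p (hs hp) q (hs hq) r (hs hr) s (hs hs')

/-- With `c`, `v` the last two points of the chain, the single triple `c v w` suffices: transitivity
first gives every triple ending in `v w`, then every triple ending in `w`. -/
lemma IsTripleChain.insert_right {α : Type*} [DecidableEq α] {φ : α → ℝ} {T : α → α → α → Prop}
    {S C : Finset α} (hφ : Set.InjOn φ S) (hT : TripleTransOn φ T S) (hCS : C ⊆ S)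
    (hC : IsTripleChain φ T C) {c v w : α} (hc : c ∈ C) (hv : v ∈ C) (hw : w ∈ S)
    (hcv : φ c < φ v) (hvw : φ v < φ w) (hmax : ∀ p ∈ C, p ≠ v → φ p ≤ φ c)
    (h : T c v w) : IsTripleChain φ T (insert w C) := by
  have hle : ∀ p ∈ C, φ p ≤ φ v := fun p hp => by
    by_cases e : p = v
    · rw [e]
    · exact (hmax p hp e).trans hcv.le
  have hlast : ∀ p ∈ C, φ p < φ v → T p v w := by
    intro p hp hpv
    by_cases e : p = c
    · rwa [e]
    · have hpc : φ p < φ c := lt_of_le_of_ne (hmax p hp fun e' => by simp [e'] at hpv)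
        fun e' => e (hφ (hCS hp) (hCS hc) e')
      exact (hT p (hCS hp) c (hCS hc) v (hCS hv) w hw hpc hcv hvw
        (hC p hp c hc v hv hpc hcv) h).2
  intro p hp q hq r hr hpq hqr
  rw [Finset.mem_insert] at hp hq hr
  have bound : ∀ x, x = w ∨ x ∈ C → φ x ≤ φ w := by
    rintro x (rfl | hx)
    · exact le_rfl
    · exact (hle x hx).trans hvw.le
  have hqC : q ∈ C := by
    rcases hq with rfl | hq
    · exact absurd hqr (not_lt.mpr (bound r hr))
    · exact hq
  have hpC : p ∈ C := by
    rcases hp with rfl | hp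
    · exact absurd hpq (not_lt.mpr (bound q hq))
    · exact hp
  rcases hr with rfl | hr
  · by_cases e : q = v
    · subst e; exact hlast p hpC hpq
    · have hqv : φ q < φ v := lt_of_le_of_ne (hle q hqC) fun e' => e (hφ (hCS hqC) (hCS hv) e')
      exact (hT p (hCS hpC) q (hCS hqC) v (hCS hv) r hw hpq hqv hvw
        (hC p hpC q hqC v hv hpq hqv) (hlast q hqC hqv)).1
  · exact hC p hpC q hqC r hr hpq hqr

lemma IsTripleChain.insert_left {α : Type*} [DecidableEq α] {φ : α → ℝ} {T : α → α → α → Prop}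
    {S C : Finset α} (hφ : Set.InjOn φ S) (hT : TripleTransOn φ T S) (hCS : C ⊆ S)
    (hC : IsTripleChain φ T C) {c v w : α} (hc : c ∈ C) (hv : v ∈ C) (hw : w ∈ S)
    (hvc : φ v < φ c) (hwv : φ w < φ v) (hmin : ∀ p ∈ C, p ≠ v → φ c ≤ φ p)
    (h : T w v c) : IsTripleChain φ T (insert w C) := by
  have key := IsTripleChain.insert_right (φ := fun x => -φ x) (T := fun p q r => T r q p)
    (S := S) (C := C) (c := c) (v := v) (w := w)
    (fun x hx y hy e => hφ hx hy (neg_injective e))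
    (fun p hp q hq r hr s hs hpq hqr hrs h₁ h₂ =>
      (hT s hs r hr q hq p hp (neg_lt_neg_iff.mp hrs) (neg_lt_neg_iff.mp hqr)
        (neg_lt_neg_iff.mp hpq) h₂ h₁).symm) hCS
    (fun p hp q hq r hr hpq hqr => hC r hr q hq p hp (neg_lt_neg_iff.mp hqr)
      (neg_lt_neg_iff.mp hpq)) hc hv hw (neg_lt_neg hvc) (neg_lt_neg hwv)
    (fun p hp hpv => neg_le_neg (hmin p hp hpv)) h
  exact fun p hp q hq r hr hpq hqr =>
    key r hr q hq p hp (neg_lt_neg hqr) (neg_lt_neg hpq)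

lemma exists_isTripleChain_two {α : Type*} (φ : α → ℝ) (T : α → α → α → Prop) {S : Finset α}
    (h : 1 < S.card) : ∃ C ⊆ S, C.card = 2 ∧ IsTripleChain φ T C := by
  classical
  obtain ⟨C, hCS, hC⟩ := Finset.exists_subset_card_eq (show 2 ≤ S.card from h)
  refine ⟨C, hCS, hC, fun p hp q hq r hr hpq hqr => ?_⟩
  exfalso
  have : ({p, q, r} : Finset α) ⊆ C := by
    intro x; simp only [Finset.mem_insert, Finset.mem_singleton]
    rintro (rfl | rfl | rfl) <;> assumption
  have h3 := Finset.card_le_card this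
  rw [Finset.card_eq_three.mpr ⟨p, q, r, fun e => by simp [e] at hpq,
    fun e => by subst e; exact lt_asymm hpq hqr, fun e => by simp [e] at hqr, rfl⟩] at h3
  omega

/-- The Erdős–Szekeres cups-caps theorem for transitive relations on triples. -/
theorem exists_isTripleChain {α : Type*} {φ : α → ℝ} {T T' : α → α → α → Prop}
    (a b : ℕ) (S : Finset α) (hφ : Set.InjOn φ S) (hT : TripleTransOn φ T S)
    (hT' : TripleTransOn φ T' S)
    (htot : ∀ p ∈ S, ∀ q ∈ S, ∀ r ∈ S, φ p < φ q → φ q < φ r → T p q r ∨ T' p q r)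
    (hcard : (a + b).choose a < S.card) :
    (∃ C ⊆ S, C.card = a + 2 ∧ IsTripleChain φ T C) ∨
      (∃ C ⊆ S, C.card = b + 2 ∧ IsTripleChain φ T' C) := by
  classical
  induction hn : a + b generalizing a b S with
  | zero =>
    obtain ⟨rfl, rfl⟩ : a = 0 ∧ b = 0 := by omega
    exact Or.inl (exists_isTripleChain_two φ T (by simpa using hcard))
  | succ n ih =>
    rcases a with _ | a
    · exact Or.inl (exists_isTripleChain_two φ T (by simpa using hcard))
    rcases b with _ | b
    · exact Or.inr (exists_isTripleChain_two φ T' (by simpa using hcard))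
    -- `E` collects the right endpoints of `T`-chains of length `a + 2`. Removing it leaves no such
    -- chain; inside it, a `T'`-chain starting at `v` meets a `T`-chain ending at `v`, and the
    -- triple around `v` extends one of them. Pascal's rule balances the two cases.
    set E := S.filter fun v => ∃ C ⊆ S, C.card = a + 2 ∧ IsTripleChain φ T C ∧ v ∈ C ∧
      ∀ p ∈ C, φ p ≤ φ v with hE
    have hES : E ⊆ S := Finset.filter_subset _ _
    have hsplit : (S \ E).card + E.card = S.card := Finset.card_sdiff_add_card_eq_card hES
    have hpascal : (a + 1 + (b + 1)).choose (a + 1) =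
        (a + (b + 1)).choose a + (a + 1 + b).choose (a + 1) := by
      rw [show a + 1 + (b + 1) = (a + 1 + b) + 1 by ring, Nat.choose_succ_succ,
        show a + (b + 1) = a + 1 + b by ring]
    by_cases hcase : (a + (b + 1)).choose a < (S \ E).card
    · have hsub : S \ E ⊆ S := Finset.sdiff_subset
      rcases ih a (b + 1) (S \ E) (hφ.mono (by exact_mod_cast hsub)) (hT.mono hsub)
        (hT'.mono hsub) (fun p hp q hq r hr => htot p (hsub hp) q (hsub hq) r (hsub hr)) hcase
        (by omega) with ⟨C, hCS, hC, hch⟩ | ⟨C, hCS, hC, hch⟩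
      · exfalso
        obtain ⟨v, hv, hmax⟩ := Finset.exists_max_image C φ (Finset.card_pos.mp (by omega))
        exact (Finset.mem_sdiff.mp (hCS hv)).2 (Finset.mem_filter.mpr
          ⟨hsub (hCS hv), C, hCS.trans hsub, hC, hch, hv, hmax⟩)
      · exact Or.inr ⟨C, hCS.trans hsub, hC, hch⟩
    · rcases ih (a + 1) b E (hφ.mono (by exact_mod_cast hES)) (hT.mono hES) (hT'.mono hES)
        (fun p hp q hq r hr => htot p (hES hp) q (hES hq) r (hES hr)) (by omega) (by omega)
        with ⟨C, hCS, hC, hch⟩ | ⟨K, hKE, hK, hKch⟩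
      · exact Or.inl ⟨C, hCS.trans hES, hC, hch⟩
      have hKS : K ⊆ S := hKE.trans hES
      obtain ⟨v, hv, hvmin⟩ := Finset.exists_min_image K φ (Finset.card_pos.mp (by omega))
      obtain ⟨hvS, C, hCS, hC, hCch, hvC, hvmax⟩ := Finset.mem_filter.mp (hKE hv)
      obtain ⟨k, hk, hkmin⟩ := Finset.exists_min_image (K.erase v) φ
        (Finset.card_pos.mp (by rw [Finset.card_erase_of_mem hv]; omega))
      obtain ⟨c, hc, hcmax⟩ := Finset.exists_max_image (C.erase v) φ
        (Finset.card_pos.mp (by rw [Finset.card_erase_of_mem hvC]; omega))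
      rw [Finset.mem_erase] at hk hc
      have hvk : φ v < φ k := lt_of_le_of_ne (hvmin k hk.2)
        fun e => hk.1 (hφ (hKS hk.2) (hKS hv) e.symm)
      have hcv : φ c < φ v := lt_of_le_of_ne (hvmax c hc.2)
        fun e => hc.1 (hφ (hCS hc.2) hvS e)
      rcases htot c (hCS hc.2) v hvS k (hKS hk.2) hcv hvk with h | h
      · left
        refine ⟨insert k C, Finset.insert_subset (hKS hk.2) hCS, ?_,
          hCch.insert_right hφ hT hCS hc.2 hvC (hKS hk.2) hcv hvk
            (fun p hp hpv => hcmax p (Finset.mem_erase.mpr ⟨hpv, hp⟩)) h⟩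
        rw [Finset.card_insert_of_notMem fun hmem => absurd (hvmax k hmem) (not_le.mpr hvk), hC]
      · right
        refine ⟨insert c K, Finset.insert_subset (hCS hc.2) hKS, ?_,
          hKch.insert_left hφ hT' hKS hk.2 hv (hCS hc.2) hvk hcv
            (fun p hp hpv => hkmin p (Finset.mem_erase.mpr ⟨hpv, hp⟩)) h⟩
        rw [Finset.card_insert_of_notMem fun hmem => absurd (hvmin c hmem) (not_le.mpr hcv), hK]

/-- Cups-caps theorem for orientations with respect to an affine form. -/
lemma exists_isTripleChain_orient {φ : Plane → ℝ} (hφ : IsAffineForm φ) {ε : ℝ} (a b : ℕ)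
    {S : Finset Plane} (hinj : Set.InjOn φ S)
    (hne : ∀ p ∈ S, ∀ q ∈ S, ∀ r ∈ S, φ p < φ q → φ q < φ r → orient ε p q r ≠ 0)
    (hcard : (a + b).choose a < S.card) :
    (∃ C ⊆ S, C.card = a + 2 ∧ IsTripleChain φ (fun p q r => 0 < orient ε p q r) C) ∨
      (∃ C ⊆ S, C.card = b + 2 ∧ IsTripleChain φ (fun p q r => 0 < orient (-ε) p q r) C) :=
  exists_isTripleChain a b S hinj
    (fun _ _ _ _ _ _ _ _ hpq hqr hrs h₁ h₂ => hφ.orient_trans hpq hqr hrs h₁ h₂)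
    (fun _ _ _ _ _ _ _ _ hpq hqr hrs h₁ h₂ => hφ.orient_trans hpq hqr hrs h₁ h₂)
    (fun p hp q hq r hr hpq hqr => by
      rw [orient_neg, neg_pos]
      exact (lt_or_gt_of_ne (hne p hp q hq r hr hpq hqr)).symm) hcard

/-! ### Mirsky's theorem. -/

/-- Mirsky's theorem in the form of a Ramsey statement. -/
lemma exists_chain_or_antichain {α : Type*} (R : α → α → Prop) (Y : Finset α)
    (htrans : ∀ p ∈ Y, ∀ q ∈ Y, ∀ r ∈ Y, R p q → R q r → R p r)
    (hirr : ∀ p ∈ Y, ¬ R p p) (a b : ℕ) (hcard : a * b < Y.card) :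
    (∃ Z ⊆ Y, a < Z.card ∧ ∀ p ∈ Z, ∀ q ∈ Z, p ≠ q → R p q ∨ R q p) ∨
      (∃ Z ⊆ Y, b < Z.card ∧ ∀ p ∈ Z, ∀ q ∈ Z, ¬ R p q) := by
  classical
  by_contra hcon
  push Not at hcon
  obtain ⟨hc, ha⟩ := hcon
  let chains (v : α) : Finset (Finset α) := Y.powerset.filter fun Z => v ∈ Z ∧
    (∀ p ∈ Z, ∀ q ∈ Z, p ≠ q → R p q ∨ R q p) ∧ ∀ p ∈ Z, p ≠ v → R p v
  -- The size of the largest chain with top `v`. It increases strictly along `R`, so its level sets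
  -- are antichains.
  let ht (v : α) : ℕ := (chains v).sup Finset.card
  have hmem : ∀ v ∈ Y, {v} ∈ chains v := by
    intro v hv
    simp +contextual [chains, hv]
  have hmaps : ∀ v ∈ Y, ht v ∈ Finset.Icc 1 a := by
    intro v hv
    rw [Finset.mem_Icc]
    constructor
    · exact (Finset.le_sup (f := Finset.card) (hmem v hv))
    · refine Finset.sup_le fun Z hZ => ?_
      simp only [chains, Finset.mem_filter, Finset.mem_powerset] at hZ
      by_contra hlt
      obtain ⟨p, hp, q, hq, hpq, h₁, h₂⟩ := hc Z hZ.1 (not_le.mp hlt)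
      rcases hZ.2.2.1 p hp q hq hpq with h | h
      · exact h₁ h
      · exact h₂ h
  have hlt : ∀ p ∈ Y, ∀ q ∈ Y, R p q → ht p < ht q := by
    intro p hp q hq hpq
    obtain ⟨Z, hZ, hZc⟩ := Finset.exists_mem_eq_sup (chains p) ⟨_, hmem p hp⟩ Finset.card
    simp only [chains, Finset.mem_filter, Finset.mem_powerset] at hZ
    obtain ⟨hZY, hpZ, hZch, hZtop⟩ := hZ
    have hbelow : ∀ z ∈ Z, R z q := by
      intro z hz
      by_cases e : z = p
      · rwa [e]
      · exact htrans z (hZY hz) p hp q hq (hZtop z hz e) hpq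
    have hqZ : q ∉ Z := fun h => hirr q hq (hbelow q h)
    have hins : insert q Z ∈ chains q := by
      simp only [chains, Finset.mem_filter, Finset.mem_powerset]
      refine ⟨Finset.insert_subset hq hZY, Finset.mem_insert_self _ _, ?_, ?_⟩
      · intro x hx y hy hxy
        rw [Finset.mem_insert] at hx hy
        rcases hx with rfl | hx
        · rcases hy with rfl | hy
          · exact absurd rfl hxy
          · exact Or.inr (hbelow y hy)
        · rcases hy with rfl | hy
          · exact Or.inl (hbelow x hx)
          · exact hZch x hx y hy hxy
      · intro x hx hxq
        exact hbelow x ((Finset.mem_insert.mp hx).resolve_left hxq)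
    have hle : (insert q Z).card ≤ ht q := Finset.le_sup (f := Finset.card) hins
    rw [Finset.card_insert_of_notMem hqZ] at hle
    have : ht p = Z.card := hZc
    omega
  obtain ⟨t, -, ht'⟩ := Finset.exists_lt_card_fiber_of_mul_lt_card_of_maps_to hmaps
    (n := b) (by simpa using hcard)
  obtain ⟨p, hp, q, hq, hpq⟩ := ha _ (Finset.filter_subset _ _) ht'
  rw [Finset.mem_filter] at hp hq
  have := hlt p hp.1 q hq.1 hpq
  omega

/-! ### Positive-fraction cups-caps. -/

/-- A set of positive density in a power of `Fin w` has a fibre over the coordinates outside `G`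
all of whose projections to the coordinates in `G` have positive density. -/
lemma exists_dense_fiber {ι : Type*} [Fintype ι] [DecidableEq ι] {w c : ℕ} (hw : 0 < w)
    (F : Finset (ι → Fin w)) (hF : w ^ Fintype.card ι ≤ c * F.card) (G : Finset ι) :
    ∃ ω₀ ∈ F, ∀ i ∈ G,
      w ≤ c * ((F.filter fun ω => ∀ j ∉ G, ω j = ω₀ j).image fun ω => ω i).card := by
  classical
  let z : Fin w := ⟨0, hw⟩
  let f : (ι → Fin w) → (ι → Fin w) := fun ω j => if j ∈ G then z else ω j
  let B : Finset (ι → Fin w) := Fintype.piFinset fun j => if j ∈ G then {z} else Finset.univ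
  have hmaps : ∀ ω ∈ F, f ω ∈ B := by
    intro ω _
    simp only [B, f, Fintype.mem_piFinset]
    intro j
    split_ifs <;> simp
  have hB : B.card * w ^ G.card = w ^ Fintype.card ι := by
    have h1 : B.card = ∏ j : ι, if j ∈ G then 1 else w := by
      simp only [B, Fintype.card_piFinset]
      refine Finset.prod_congr rfl fun j _ => ?_
      split_ifs <;> simp
    have h2 : w ^ G.card = ∏ j : ι, if j ∈ G then w else 1 := by
      rw [Finset.prod_ite_mem]; simp
    rw [h1, h2, ← Finset.prod_mul_distrib, ← Finset.card_univ, ← Finset.prod_const]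
    refine Finset.prod_congr rfl fun j _ => ?_
    split_ifs <;> simp
  obtain ⟨y, hy, hfib⟩ : ∃ y ∈ B, w ^ G.card ≤ c * (F.filter fun ω => f ω = y).card := by
    by_contra hcon
    push Not at hcon
    have hne : B.Nonempty := by
      rw [← Finset.card_pos]
      refine Nat.pos_of_ne_zero fun h0 => ?_
      rw [h0, zero_mul] at hB
      exact absurd hB.symm (pow_pos hw _).ne'
    have hs := Finset.card_eq_sum_card_fiberwise hmaps
    have : c * F.card < B.card * w ^ G.card := by
      rw [hs, Finset.mul_sum, ← smul_eq_mul (B.card), ← Finset.sum_const]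
      exact Finset.sum_lt_sum_of_nonempty hne hcon
    omega
  have hpos : 0 < (F.filter fun ω => f ω = y).card := by
    refine Nat.pos_of_ne_zero fun h0 => ?_
    rw [h0, mul_zero] at hfib
    exact absurd (pow_pos hw _) (not_lt.mpr hfib)
  obtain ⟨ω₀, hω₀⟩ := Finset.card_pos.mp hpos
  rw [Finset.mem_filter] at hω₀
  refine ⟨ω₀, hω₀.1, fun i hi => ?_⟩
  set H := F.filter fun ω => ∀ j ∉ G, ω j = ω₀ j with hH
  have hsub : (F.filter fun ω => f ω = y) ⊆ H := by
    intro ω hω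
    rw [Finset.mem_filter] at hω
    rw [hH, Finset.mem_filter]
    refine ⟨hω.1, fun j hj => ?_⟩
    have := congrFun (hω.2.trans hω₀.2.symm) j
    simpa [f, hj] using this
  have hbox : H ⊆ Fintype.piFinset fun j => H.image fun ω => ω j := by
    intro ω hω
    rw [Fintype.mem_piFinset]
    exact fun j => Finset.mem_image_of_mem _ hω
  -- `H` lies in the product of its projections, which are singletons outside `G` and have at most
  -- `w` elements in the other coordinates of `G`. High density thus forces a large projection to
  -- `i`.
  have hle : H.card ≤ (H.image fun ω => ω i).card * w ^ (G.card - 1) := by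
    refine (Finset.card_le_card hbox).trans ?_
    rw [Fintype.card_piFinset, ← Finset.mul_prod_erase _ _ (Finset.mem_univ i)]
    refine Nat.mul_le_mul_left _ ?_
    have h2 : w ^ (G.card - 1) = ∏ j ∈ Finset.univ.erase i, if j ∈ G then w else 1 := by
      rw [Finset.prod_ite_mem, Finset.prod_const, ← Finset.card_erase_of_mem hi]
      congr 2
      ext j; simp
    rw [h2]
    refine Finset.prod_le_prod' fun j _ => ?_
    split_ifs with hj
    · exact (Finset.card_le_univ _).trans (by simp)
    · refine Finset.card_le_one.mpr fun x hx y hy => ?_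
      obtain ⟨ω, hω, rfl⟩ := Finset.mem_image.mp hx
      obtain ⟨ω', hω', rfl⟩ := Finset.mem_image.mp hy
      rw [(Finset.mem_filter.mp hω).2 j hj, (Finset.mem_filter.mp hω').2 j hj]
  have hG : w ^ G.card = w * w ^ (G.card - 1) := by
    rw [← pow_succ', Nat.sub_add_cancel (Finset.card_pos.mpr ⟨i, hi⟩)]
  refine Nat.le_of_mul_le_mul_right (c := w ^ (G.card - 1)) ?_ (pow_pos hw _)
  calc w * w ^ (G.card - 1) = w ^ G.card := hG.symm
    _ ≤ c * H.card := hfib.trans (Nat.mul_le_mul_left _ (Finset.card_le_card hsub))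
    _ ≤ c * (H.image fun ω => ω i).card * w ^ (G.card - 1) := by
      rw [mul_assoc]; exact Nat.mul_le_mul_left _ hle

/-- Transitivity propagates the sign from consecutive triples to all triples. Hence a mixed
transversal need only be controlled three neighbouring families at a time. -/
lemma IsAffineForm.orient_pos_of_consecutive {φ : Plane → ℝ} (hφ : IsAffineForm φ) {ε : ℝ} {K : ℕ}
    {z : ℕ → Plane} (hmono : ∀ a b, a < b → b < K → φ (z a) < φ (z b))
    (h : ∀ k, k + 2 < K → 0 < orient ε (z k) (z (k + 1)) (z (k + 2)))
    {a b c : ℕ} (hab : a < b) (hbc : b < c) (hc : c < K) :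
    0 < orient ε (z a) (z b) (z c) := by
  have h₁ : ∀ b, a < b → b + 1 < K → 0 < orient ε (z a) (z b) (z (b + 1)) := by
    intro b hab
    induction b, hab using Nat.le_induction with
    | base => exact fun hK => h a hK
    | succ b hab ih =>
      intro hK
      exact (hφ.orient_trans (hmono _ _ hab (by omega)) (hmono _ _ (by omega) (by omega))
        (hmono _ _ (by omega) hK) (ih (by omega)) (h b hK)).2
  have h₂ : ∀ b c, b < c → c + 1 < K → 0 < orient ε (z b) (z c) (z (c + 1)) := by
    intro b c hbc
    induction c, hbc using Nat.le_induction with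
    | base => exact fun hK => h b hK
    | succ c hbc ih =>
      intro hK
      exact (hφ.orient_trans (hmono _ _ hbc (by omega)) (hmono _ _ (by omega) (by omega))
        (hmono _ _ (by omega) hK) (ih (by omega)) (h c hK)).2
  induction c, hbc using Nat.le_induction with
  | base => exact h₁ b hab hc
  | succ c hbc ih =>
    exact (hφ.orient_trans (hmono _ _ hab (by omega)) (hmono _ _ hbc (by omega))
      (hmono _ _ (by omega) hc) (ih (by omega)) (h₂ b c hbc hc)).1

/-- Cut a finite set, sorted by `φ`, into `M` consecutive pieces of size `w`. -/
lemma exists_sorted_grid {φ : Plane → ℝ} {P : Finset Plane} (hinj : Set.InjOn φ P) {M w : ℕ}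
    (h : M * w ≤ P.card) :
    ∃ pt : Fin M → Fin w → Plane, (∀ j x, pt j x ∈ P) ∧
      (∀ j j' x x', j < j' → φ (pt j x) < φ (pt j' x')) ∧ ∀ j, Function.Injective (pt j) := by
  classical
  have hs : (P.image φ).card = P.card := Finset.card_image_of_injOn hinj
  let e := (P.image φ).orderEmbOfFin hs
  have he : ∀ i, ∃ p ∈ P, φ p = e i := fun i =>
    Finset.mem_image.mp (Finset.orderEmbOfFin_mem _ hs i)
  choose g hgP hg using he
  have hbound : ∀ (j : Fin M) (x : Fin w), j.1 * w + x.1 < P.card := by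
    intro j x
    have : (j.1 + 1) * w ≤ M * w := Nat.mul_le_mul_right _ j.2
    have := x.2
    nlinarith
  refine ⟨fun j x => g ⟨j.1 * w + x.1, hbound j x⟩, fun j x => hgP _, fun j j' x x' hj => ?_,
    fun j x x' hxx => ?_⟩
  · rw [hg, hg, e.lt_iff_lt, Fin.mk_lt_mk]
    have : (j.1 + 1) * w ≤ j'.1 * w := Nat.mul_le_mul_right _ hj
    have := x.2
    nlinarith
  · have h1 := congrArg φ hxx
    simp only [hg] at h1
    have h2 := e.injective h1
    simp only [Fin.mk.injEq, add_right_inj] at h2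
    exact Fin.ext h2

/-- A positive-fraction version of the cups-caps theorem: `K` consecutive families of points such
that every choice of one point from each family is a cap (`ε < 0`) or a cup (`ε > 0`), where every
third family contains a positive fraction of the points. -/
lemma exists_positive_fraction (K : ℕ) :
    ∃ M c : ℕ, ∀ (P : Finset Plane), InGeneralPosition P → ∀ φ : Plane → ℝ, IsAffineForm φ →
      Set.InjOn φ P → ∀ w : ℕ, 0 < w → M * w ≤ P.card →
      ∃ ε : ℝ, ε ≠ 0 ∧ ∃ Y : ℕ → Finset Plane,
        (∀ k < K, Y k ⊆ P ∧ (Y k).Nonempty) ∧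
        (∀ k < K, k % 3 = 1 → w ≤ c * (Y k).card) ∧
        (∀ a b, a < b → b < K → ∀ p ∈ Y a, ∀ q ∈ Y b, φ p < φ q) ∧
        (∀ a b d, a < b → b < d → d < K → ∀ p ∈ Y a, ∀ q ∈ Y b, ∀ r ∈ Y d,
          0 < orient ε p q r) := by
  classical
  -- One more than the cups-caps bound: each choice `ω` of one point per piece contains `K` pieces
  -- whose points form a cup or a cap. The sign and the set of pieces are the colour of `ω`, and `c`
  -- is the number of colours.
  obtain ⟨M, hM⟩ : ∃ M, M = (K + K).choose K + 1 := ⟨_, rfl⟩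
  refine ⟨M, Fintype.card (Bool × Finset (Fin M)), fun P hP φ hφ hinj w hw hcard => ?_⟩
  obtain ⟨pt, hptP, hptlt, hptinj⟩ := exists_sorted_grid hinj hcard
  let sgn : Bool → ℝ := fun s => if s then 1 else -1
  have hcol : ∀ ω : Fin M → Fin w, ∃ x : Bool × Finset (Fin M), x.2.card = K ∧
      ∀ i ∈ x.2, ∀ j ∈ x.2, ∀ k ∈ x.2, i < j → j < k →
        0 < orient (sgn x.1) (pt i (ω i)) (pt j (ω j)) (pt k (ω k)) := by
    intro ω
    have hlt : ∀ i j : Fin M, ((i : ℕ) : ℝ) < ((j : ℕ) : ℝ) ↔ i < j := by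
      intro i j; rw [Nat.cast_lt]; rfl
    have tr : ∀ ε : ℝ, TripleTransOn (fun i : Fin M => ((i : ℕ) : ℝ))
        (fun i j k => 0 < orient ε (pt i (ω i)) (pt j (ω j)) (pt k (ω k))) Finset.univ := by
      intro ε i _ j _ k _ l _ hij hjk hkl h₁ h₂
      exact hφ.orient_trans (hptlt _ _ _ _ ((hlt _ _).mp hij)) (hptlt _ _ _ _ ((hlt _ _).mp hjk))
        (hptlt _ _ _ _ ((hlt _ _).mp hkl)) h₁ h₂
    have hne : ∀ i j, i < j → pt i (ω i) ≠ pt j (ω j) := by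
      intro i j hij e
      have := hptlt i j (ω i) (ω j) hij
      rw [e] at this
      exact lt_irrefl _ this
    have extract : ∀ s : Bool, (∃ C ⊆ (Finset.univ : Finset (Fin M)), C.card = K + 2 ∧
        IsTripleChain (fun i : Fin M => ((i : ℕ) : ℝ))
          (fun i j k => 0 < orient (sgn s) (pt i (ω i)) (pt j (ω j)) (pt k (ω k))) C) →
        ∃ x : Bool × Finset (Fin M), x.2.card = K ∧
          ∀ i ∈ x.2, ∀ j ∈ x.2, ∀ k ∈ x.2, i < j → j < k →
            0 < orient (sgn x.1) (pt i (ω i)) (pt j (ω j)) (pt k (ω k)) := by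
      rintro s ⟨C, -, hC, hch⟩
      obtain ⟨D, hDC, hD⟩ := Finset.exists_subset_card_eq (show K ≤ C.card by omega)
      exact ⟨(s, D), hD, fun i hi j hj k hk hij hjk => hch i (hDC hi) j (hDC hj) k (hDC hk)
        ((hlt _ _).mpr hij) ((hlt _ _).mpr hjk)⟩
    rcases exists_isTripleChain K K Finset.univ
      (fun i _ j _ e => Fin.ext (Nat.cast_injective e)) (tr 1) (tr (-1))
      (fun i _ j _ k _ hij hjk => by
        have hij := (hlt _ _).mp hij
        have hjk := (hlt _ _).mp hjk
        rw [orient_neg, neg_pos]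
        exact (lt_or_gt_of_ne (hP.orient_ne_zero one_ne_zero (hptP _ _) (hptP _ _) (hptP _ _)
          (hne _ _ hij) (hne _ _ (hij.trans hjk)) (hne _ _ hjk))).symm)
      (by rw [Finset.card_univ, Fintype.card_fin]; omega) with h | h
    · exact extract true (by simpa [sgn] using h)
    · exact extract false (by simpa [sgn] using h)
  choose col hcolcard hcolch using hcol
  obtain ⟨⟨s, J⟩, hx⟩ : ∃ x, w ^ Fintype.card (Fin M) ≤ Fintype.card (Bool × Finset (Fin M)) *
      (Finset.univ.filter fun ω => col ω = x).card := by
    by_contra hcon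
    push Not at hcon
    have hs := Finset.card_eq_sum_card_fiberwise (f := col) (s := Finset.univ)
      (t := Finset.univ) (fun _ _ => Finset.mem_univ _)
    have h1 : Fintype.card (Bool × Finset (Fin M)) * (Finset.univ : Finset (Fin M → Fin w)).card <
        Fintype.card (Bool × Finset (Fin M)) * w ^ Fintype.card (Fin M) := by
      rw [hs, Finset.mul_sum]
      refine (Finset.sum_lt_sum_of_nonempty Finset.univ_nonempty fun x _ => hcon x).trans_eq ?_
      rw [Finset.sum_const, Finset.card_univ, smul_eq_mul]
    simp at h1
  set F := Finset.univ.filter fun ω => col ω = (s, J) with hF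
  have hFcol : ∀ ω ∈ F, col ω = (s, J) := fun ω hω => (Finset.mem_filter.mp hω).2
  obtain ⟨ω', hω'⟩ : F.Nonempty := by
    rw [← Finset.card_pos]
    refine Nat.pos_of_ne_zero fun h0 => ?_
    rw [h0, mul_zero] at hx
    exact absurd (pow_pos hw _) (not_lt.mpr hx)
  have hJ : J.card = K := by
    have := hcolcard ω'
    rwa [hFcol ω' hω'] at this
  let e := J.orderEmbOfFin hJ
  have heJ : ∀ k, e k ∈ J := fun k => Finset.orderEmbOfFin_mem _ hJ k
  -- Only these pieces may vary; the other families become single points. Any three consecutive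
  -- positions contain exactly one varying piece.
  let G : Finset (Fin M) := (Finset.univ.filter fun k : Fin K => k.1 % 3 = 1).image e
  have hG : ∀ k, e k ∈ G ↔ k.1 % 3 = 1 := by
    intro k
    simp [G]
  obtain ⟨ω₀, hω₀, hdense⟩ := exists_dense_fiber hw F hx G
  set H := F.filter fun ω => ∀ j ∉ G, ω j = ω₀ j with hH
  have hω₀H : ω₀ ∈ H := Finset.mem_filter.mpr ⟨hω₀, fun _ _ => rfl⟩
  let Y : ℕ → Finset Plane := fun k =>
    if hk : k < K then H.image fun ω => pt (e ⟨k, hk⟩) (ω (e ⟨k, hk⟩)) else ∅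
  have hY : ∀ k (hk : k < K) p, p ∈ Y k → ∃ ω ∈ H, p = pt (e ⟨k, hk⟩) (ω (e ⟨k, hk⟩)) := by
    intro k hk p hp
    simp only [Y, dif_pos hk, Finset.mem_image] at hp
    obtain ⟨ω, hω, rfl⟩ := hp
    exact ⟨ω, hω, rfl⟩
  have hYfix : ∀ k (hk : k < K), k % 3 ≠ 1 → ∀ p ∈ Y k, ∀ ω ∈ H,
      p = pt (e ⟨k, hk⟩) (ω (e ⟨k, hk⟩)) := by
    intro k hk hk3 p hp ω hω
    obtain ⟨ω₁, hω₁, rfl⟩ := hY k hk p hp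
    have hnG : e ⟨k, hk⟩ ∉ G := fun h => hk3 ((hG _).mp h)
    rw [(Finset.mem_filter.mp hω₁).2 _ hnG, (Finset.mem_filter.mp hω).2 _ hnG]
  have hYlt : ∀ a b, a < b → b < K → ∀ p ∈ Y a, ∀ q ∈ Y b, φ p < φ q := by
    intro a b hab hb p hp q hq
    obtain ⟨ω₁, -, rfl⟩ := hY a (hab.trans hb) p hp
    obtain ⟨ω₂, -, rfl⟩ := hY b hb q hq
    exact hptlt _ _ _ _ (e.strictMono hab)
  have hYne : ∀ k < K, Y k ⊆ P ∧ (Y k).Nonempty := by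
    intro k hk
    constructor
    · intro p hp
      obtain ⟨ω, -, rfl⟩ := hY k hk p hp
      exact hptP _ _
    · simp only [Y, dif_pos hk]
      exact ⟨_, Finset.mem_image_of_mem _ hω₀H⟩
  have hHch : ∀ ω ∈ H, ∀ i j k : Fin K, i < j → j < k →
      0 < orient (sgn s) (pt (e i) (ω (e i))) (pt (e j) (ω (e j))) (pt (e k) (ω (e k))) := by
    intro ω hω i j k hij hjk
    have hc := hFcol ω (Finset.mem_filter.mp hω).1
    have := hcolch ω
    rw [hc] at this
    exact this _ (heJ i) _ (heJ j) _ (heJ k) (e.strictMono hij) (e.strictMono hjk)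
  refine ⟨sgn s, by cases s <;> simp [sgn], Y, hYne, ?_, hYlt, ?_⟩
  · intro k hk hk3
    refine (hdense (e ⟨k, hk⟩) ((hG _).mpr hk3)).trans (Nat.mul_le_mul_left _ ?_)
    rw [← Finset.card_image_of_injective _ (hptinj (e ⟨k, hk⟩)), Finset.image_image]
    simp only [Y, dif_pos hk]
    exact le_of_eq (by congr!)
  · intro a b d hab hbd hd p hp q hq r hr
    choose! y hy using fun k (hk : k < K) => (hYne k hk).2
    -- Complete `p`, `q`, `r` to a full transversal, so that only its consecutive triples remain to
    -- be checked.
    let z : ℕ → Plane := fun k => if k = a then p else if k = b then q else if k = d then r else y k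
    have hz : ∀ k < K, z k ∈ Y k := by
      intro k hk
      simp only [z]
      split_ifs with h₁ h₂ h₃
      · rwa [h₁]
      · rwa [h₂]
      · rwa [h₃]
      · exact hy k hk
    have key := hφ.orient_pos_of_consecutive (ε := sgn s) (K := K) (z := z)
      (fun i j hij hj => hYlt i j hij hj _ (hz i (hij.trans hj)) _ (hz j hj))
      (fun k hk => by
        have h0 : k < K := by omega
        have h1 : k + 1 < K := by omega
        -- The one varying point among the three selects `ω`; the two fixed points agree with every
        -- member of `H`. So the triple comes from a single coloured choice.
        obtain ⟨ω, hω, e0, e1, e2⟩ : ∃ ω ∈ H, z k = pt (e ⟨k, h0⟩) (ω (e ⟨k, h0⟩)) ∧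
            z (k + 1) = pt (e ⟨k + 1, h1⟩) (ω (e ⟨k + 1, h1⟩)) ∧
            z (k + 2) = pt (e ⟨k + 2, hk⟩) (ω (e ⟨k + 2, hk⟩)) := by
          have hmod : k % 3 = 1 ∨ (k + 1) % 3 = 1 ∨ (k + 2) % 3 = 1 := by omega
          rcases hmod with h | h | h
          · obtain ⟨ω, hω, e⟩ := hY k h0 _ (hz k h0)
            exact ⟨ω, hω, e, hYfix _ h1 (by omega) _ (hz _ h1) ω hω,
              hYfix _ hk (by omega) _ (hz _ hk) ω hω⟩
          · obtain ⟨ω, hω, e⟩ := hY _ h1 _ (hz _ h1)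
            exact ⟨ω, hω, hYfix _ h0 (by omega) _ (hz _ h0) ω hω, e,
              hYfix _ hk (by omega) _ (hz _ hk) ω hω⟩
          · obtain ⟨ω, hω, e⟩ := hY _ hk _ (hz _ hk)
            exact ⟨ω, hω, hYfix _ h0 (by omega) _ (hz _ h0) ω hω,
              hYfix _ h1 (by omega) _ (hz _ h1) ω hω, e⟩
        rw [e0, e1, e2]
        exact hHch ω hω _ _ _ (Fin.mk_lt_mk.mpr (by omega)) (Fin.mk_lt_mk.mpr (by omega)))
      hab hbd hd
    have ea : z a = p := by simp [z]
    have eb : z b = q := by simp [z, hab.ne']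
    have ed : z d = r := by simp [z, hbd.ne', (hab.trans hbd).ne']
    rwa [ea, eb, ed] at key

/-! ### The triangle order over a base. -/

/-- For points on the positive side of the line `ℓ r`: the point `p` lies in the interior of the
triangle `ℓ q r`. -/
def InTriangle (ε : ℝ) (ℓ r p q : Plane) : Prop :=
  orient ε ℓ p q < 0 ∧ 0 < orient ε p q r

lemma not_inTriangle_self (ε : ℝ) (ℓ r p : Plane) : ¬ InTriangle ε ℓ r p p := by
  intro h
  have : orient ε ℓ p p = 0 := by unfold orient; ring
  exact absurd h.1 (by rw [this]; exact lt_irrefl _)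

lemma InTriangle.trans {ε : ℝ} {ℓ r p q s : Plane} (hp : 0 < orient ε ℓ p r)
    (hq : 0 < orient ε ℓ q r) (hs : 0 < orient ε ℓ s r)
    (hpq : InTriangle ε ℓ r p q) (hqs : InTriangle ε ℓ r q s) : InTriangle ε ℓ r p s := by
  obtain ⟨h₁, h₂⟩ := hpq
  obtain ⟨h₃, h₄⟩ := hqs
  constructor
  · have e : orient ε ℓ p s * orient ε ℓ q r =
        orient ε ℓ p q * orient ε ℓ s r + orient ε ℓ p r * orient ε ℓ q s := by
      unfold orient; ring
    nlinarith [mul_pos (neg_pos.mpr h₁) hs, mul_pos hp (neg_pos.mpr h₃)]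
  · have e : orient ε p s r * orient ε ℓ q r =
        orient ε p q r * orient ε ℓ s r + orient ε ℓ p r * orient ε q s r := by
      unfold orient; ring
    refine pos_of_mul_pos_left (b := orient ε ℓ q r) ?_ hq.le
    rw [e]
    exact add_pos (mul_pos h₂ hs) (mul_pos hp h₄)

/-- Sorting a chain by its height over the base therefore recovers the triangle order. Since the
height is affine, cups-caps applies to chains sorted this way. -/
lemma InTriangle.height_lt {ε : ℝ} {ℓ r p q : Plane} (h : InTriangle ε ℓ r p q) :
    orient ε ℓ p r < orient ε ℓ q r := by
  have e : orient ε ℓ p q + orient ε ℓ q r = orient ε ℓ p r + orient ε p q r := by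
    unfold orient; ring
  linarith [h.1, h.2]

lemma isAffineForm_orient (ε : ℝ) (ℓ r : Plane) : IsAffineForm fun p => orient ε ℓ p r :=
  ⟨ε * (r 1 - ℓ 1), -(ε * (r 0 - ℓ 0)),
    ε * (-(ℓ 0 * (r 1 - ℓ 1)) + ℓ 1 * (r 0 - ℓ 0)), fun p => by unfold orient; ring⟩

/-- In a convex quadrilateral `ℓ p q r`, a line through `p` leaving between `ℓ` and `r` has `q` on
the side of `r`. -/
lemma InTriangle.orient_right {ε : ℝ} {ℓ r p p' q : Plane} (h : InTriangle ε ℓ r p p')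
    (hp : 0 < orient ε ℓ p r) (h₁ : 0 < orient ε ℓ p q) (h₂ : 0 < orient ε p q r) :
    0 < orient ε p p' q := by
  have e : orient ε p p' q * orient ε ℓ p r =
      -orient ε ℓ p p' * orient ε p q r + orient ε p p' r * orient ε ℓ p q := by
    unfold orient; ring
  refine pos_of_mul_pos_left (b := orient ε ℓ p r) ?_ hp.le
  rw [e]
  exact add_pos (mul_pos (neg_pos.mpr h.1) h₂) (mul_pos h.2 h₁)

/-- In a convex quadrilateral `ℓ p q r`, a line through `q` leaving between `ℓ` and `r` has `p` on
the side of `ℓ`. -/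
lemma InTriangle.orient_left {ε : ℝ} {ℓ r p q q' : Plane} (h : InTriangle ε ℓ r q q')
    (hq : 0 < orient ε ℓ q r) (h₁ : 0 < orient ε ℓ p q) (h₂ : 0 < orient ε p q r) :
    0 < orient ε p q' q := by
  have e : orient ε p q' q * orient ε ℓ q r =
      -orient ε ℓ q q' * orient ε p q r + orient ε q q' r * orient ε ℓ p q := by
    unfold orient; ring
  refine pos_of_mul_pos_left (b := orient ε ℓ q r) ?_ hq.le
  rw [e]
  exact add_pos (mul_pos (neg_pos.mpr h.1) h₂) (mul_pos h.2 h₁)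

/-- A left-convex chain followed by a right-convex chain over the same base is in convex
position. -/
lemma inConvexPosition_union {ε : ℝ} {ℓ r : Plane} {U V : Finset Plane} [DecidableEq Plane]
    (hU : ∀ p ∈ U, 0 < orient ε ℓ p r) (hV : ∀ q ∈ V, 0 < orient ε ℓ q r)
    (hUV : ∀ p ∈ U, ∀ q ∈ V, 0 < orient ε ℓ p q ∧ 0 < orient ε p q r)
    (hUt : ∀ p ∈ U, ∀ q ∈ U, orient ε ℓ p r < orient ε ℓ q r → InTriangle ε ℓ r p q)
    (hVt : ∀ p ∈ V, ∀ q ∈ V, orient ε ℓ p r < orient ε ℓ q r → InTriangle ε ℓ r p q)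
    (hUinj : Set.InjOn (fun p => orient ε ℓ p r) U) (hVinj : Set.InjOn (fun p => orient ε ℓ p r) V)
    (hdisj : Disjoint U V) (hcard : 2 ≤ (U ∪ V).card)
    (hUc : IsTripleChain (fun p => orient ε ℓ p r) (fun p q s => 0 < orient ε p q s) U)
    (hVc : IsTripleChain (fun p => orient ε ℓ p r) (fun p q s => 0 < orient (-ε) p q s) V) :
    InConvexPosition (U ∪ V) := by
  let ψ : Plane → ℝ := fun p => orient ε ℓ p r
  -- This lists `U` by increasing height and then `V` by decreasing height: up the left side of the
  -- polygon and down the right side.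
  let κ : Plane → ℝ := fun p => if p ∈ U then -(ψ p)⁻¹ else (ψ p)⁻¹
  have κU : ∀ p ∈ U, κ p = -(ψ p)⁻¹ := fun p hp => if_pos hp
  have κV : ∀ p ∈ V, κ p = (ψ p)⁻¹ := fun p hp =>
    if_neg fun h => Finset.disjoint_left.mp hdisj h hp
  have κUneg : ∀ p ∈ U, κ p < 0 := fun p hp => by
    rw [κU p hp]; exact neg_lt_zero.mpr (inv_pos.mpr (hU p hp))
  have κVpos : ∀ p ∈ V, 0 < κ p := fun p hp => by
    rw [κV p hp]; exact inv_pos.mpr (hV p hp)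
  have ltU : ∀ p ∈ U, ∀ q ∈ U, κ p < κ q → ψ p < ψ q := by
    intro p hp q hq h
    rw [κU p hp, κU q hq, neg_lt_neg_iff] at h
    exact (inv_lt_inv₀ (hU q hq) (hU p hp)).mp h
  have ltV : ∀ p ∈ V, ∀ q ∈ V, κ p < κ q → ψ q < ψ p := by
    intro p hp q hq h
    rw [κV p hp, κV q hq] at h
    exact (inv_lt_inv₀ (hV p hp) (hV q hq)).mp h
  have notVU : ∀ p ∈ V, ∀ q ∈ U, ¬ κ p < κ q := fun p hp q hq h =>
    lt_irrefl _ ((κVpos p hp).trans (h.trans (κUneg q hq)))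
  refine inConvexPosition_of_isTripleChain (κ := κ) (ε := ε) ?_ hcard ?_
  · intro p hp q hq e
    rw [Finset.mem_coe, Finset.mem_union] at hp hq
    rcases hp with hp | hp <;> rcases hq with hq | hq
    · rw [κU p hp, κU q hq] at e
      exact hUinj hp hq (inv_injective (neg_injective e))
    · linarith [κUneg p hp, κVpos q hq]
    · linarith [κUneg q hq, κVpos p hp]
    · rw [κV p hp, κV q hq] at e
      exact hVinj hp hq (inv_injective e)
  · intro p hp q hq s hs hpq hqs
    rw [Finset.mem_union] at hp hq hs
    rcases hp with hp | hp
    · rcases hq with hq | hq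
      · have hpq' := ltU p hp q hq hpq
        rcases hs with hs | hs
        · exact hUc p hp q hq s hs hpq' (ltU q hq s hs hqs)
        · exact (hUt p hp q hq hpq').orient_right (hU p hp) (hUV p hp s hs).1 (hUV p hp s hs).2
      · rcases hs with hs | hs
        · exact absurd hqs (notVU q hq s hs)
        · exact (hVt s hs q hq (ltV q hq s hs hqs)).orient_left (hV s hs) (hUV p hp s hs).1
            (hUV p hp s hs).2
    · rcases hq with hq | hq
      · exact absurd hpq (notVU p hp q hq)
      · rcases hs with hs | hs
        · exact absurd hqs (notVU q hq s hs)
        · have h : 0 < orient (-ε) s q p :=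
            hVc s hs q hq p hp (ltV q hq s hs hqs) (ltV p hp q hq hpq)
          have e : orient (-ε) s q p = orient ε p q s := by unfold orient; ring
          exact e ▸ h

/-- Two adjacent families over a common base `ℓ r`, each with a long chain for the triangle
order, contain a large convex polygon. -/
lemma exists_inConvexPosition_of_chains {P : Finset Plane} (hP : InGeneralPosition P) {ε : ℝ}
    (hε : ε ≠ 0) {ℓ r : Plane} {A B : Finset Plane} (hAP : A ⊆ P) (hBP : B ⊆ P)
    (hA : ∀ p ∈ A, 0 < orient ε ℓ p r) (hB : ∀ q ∈ B, 0 < orient ε ℓ q r)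
    (hAB : ∀ p ∈ A, ∀ q ∈ B, 0 < orient ε ℓ p q ∧ 0 < orient ε p q r)
    (hdisj : Disjoint A B)
    (hAc : ∀ p ∈ A, ∀ q ∈ A, p ≠ q → InTriangle ε ℓ r p q ∨ InTriangle ε ℓ r q p)
    (hBc : ∀ p ∈ B, ∀ q ∈ B, p ≠ q → InTriangle ε ℓ r p q ∨ InTriangle ε ℓ r q p)
    {h n : ℕ} (hn : n ≤ 2 * h) (hAcard : (h + n).choose h < A.card)
    (hBcard : (h + n).choose h < B.card) :
    ∃ Q ⊆ P, n ≤ Q.card ∧ InConvexPosition Q := by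
  classical
  let ψ : Plane → ℝ := fun p => orient ε ℓ p r
  have hψ : IsAffineForm ψ := isAffineForm_orient ε ℓ r
  have inj : ∀ Z : Finset Plane,
      (∀ p ∈ Z, ∀ q ∈ Z, p ≠ q → InTriangle ε ℓ r p q ∨ InTriangle ε ℓ r q p) →
      Set.InjOn ψ Z := by
    intro Z hZ p hp q hq e
    by_contra hne
    rcases hZ p hp q hq hne with h | h
    · exact absurd e h.height_lt.ne
    · exact absurd e h.height_lt.ne'
  have tri : ∀ Z : Finset Plane,
      (∀ p ∈ Z, ∀ q ∈ Z, p ≠ q → InTriangle ε ℓ r p q ∨ InTriangle ε ℓ r q p) →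
      ∀ p ∈ Z, ∀ q ∈ Z, ψ p < ψ q → InTriangle ε ℓ r p q := by
    intro Z hZ p hp q hq hlt
    rcases hZ p hp q hq (fun e => by simp [e] at hlt) with h | h
    · exact h
    · exact absurd h.height_lt (not_lt.mpr hlt.le)
  have hne : ∀ Z ⊆ P, ∀ δ : ℝ, δ ≠ 0 → ∀ p ∈ Z, ∀ q ∈ Z, ∀ s ∈ Z, ψ p < ψ q → ψ q < ψ s →
      orient δ p q s ≠ 0 := by
    intro Z hZ δ hδ p hp q hq s hs hpq hqs
    exact hP.orient_ne_zero hδ (hZ hp) (hZ hq) (hZ hs) (fun e => by simp [e] at hpq)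
      (fun e => by subst e; exact lt_asymm hpq hqs) (fun e => by simp [e] at hqs)
  -- The outcome of cups-caps in which one family alone already contains the polygon.
  have single : ∀ (δ : ℝ) (Z : Finset Plane), Z ⊆ P →
      (∀ p ∈ Z, ∀ q ∈ Z, p ≠ q → InTriangle ε ℓ r p q ∨ InTriangle ε ℓ r q p) →
      (∃ C ⊆ Z, C.card = n + 2 ∧ IsTripleChain ψ (fun p q s => 0 < orient δ p q s) C) →
      ∃ Q ⊆ P, n ≤ Q.card ∧ InConvexPosition Q := by
    rintro δ Z hZP hZ ⟨C, hCZ, hC, hch⟩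
    exact ⟨C, hCZ.trans hZP, by omega, inConvexPosition_of_isTripleChain
      ((inj Z hZ).mono (by exact_mod_cast hCZ)) (by omega) hch⟩
  rcases exists_isTripleChain_orient hψ h n (inj A hAc) (hne A hAP ε hε) hAcard with
    ⟨U, hUA, hU, hUc⟩ | h1
  swap
  · exact single (-ε) A hAP hAc h1
  rcases exists_isTripleChain_orient hψ h n (inj B hBc) (hne B hBP (-ε) (neg_ne_zero.mpr hε))
    hBcard with ⟨V, hVB, hV, hVc⟩ | h1
  swap
  · exact single (- -ε) B hBP hBc h1
  have hd : Disjoint U V := Finset.disjoint_of_subset_left hUA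
    (Finset.disjoint_of_subset_right hVB hdisj)
  have hc : (U ∪ V).card = 2 * h + 4 := by
    rw [Finset.card_union_of_disjoint hd]; omega
  refine ⟨U ∪ V, Finset.union_subset (hUA.trans hAP) (hVB.trans hBP), by omega,
    inConvexPosition_union (fun p hp => hA p (hUA hp)) (fun p hp => hB p (hVB hp))
      (fun p hp q hq => hAB p (hUA hp) q (hVB hq))
      (fun p hp q hq => tri A hAc p (hUA hp) q (hUA hq))
      (fun p hp q hq => tri B hBc p (hVB hp) q (hVB hq))
      ((inj A hAc).mono (by exact_mod_cast hUA)) ((inj B hBc).mono (by exact_mod_cast hVB))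
      hd (by omega) hUc hVc⟩

/-- Two incomparable points over the base `ℓ r` form a convex quadrilateral with `ℓ` and `r`. -/
lemma IsAffineForm.orient_pos_of_not_inTriangle {φ : Plane → ℝ} (hφ : IsAffineForm φ) {ε : ℝ}
    {ℓ r p q : Plane} (hℓp : φ ℓ < φ p) (hpq : φ p < φ q) (hqr : φ q < φ r)
    (hp : 0 < orient ε ℓ p r) (h₁ : orient ε ℓ p q ≠ 0) (h₂ : orient ε p q r ≠ 0)
    (hpq' : ¬ InTriangle ε ℓ r p q) (hqp' : ¬ InTriangle ε ℓ r q p) :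
    0 < orient ε ℓ p q ∧ 0 < orient ε p q r := by
  have e₁ : orient ε ℓ q p = -orient ε ℓ p q := by unfold orient; ring
  have e₂ : orient ε q p r = -orient ε p q r := orient_swap ε p q r
  unfold InTriangle at hpq' hqp'
  rw [e₁, e₂] at hqp'
  rcases lt_or_gt_of_ne h₁ with h₁ | h₁ <;> rcases lt_or_gt_of_ne h₂ with h₂ | h₂
  -- Two negative signs would make `ℓ p r` negative by transitivity. The two mixed sign patterns are
  -- exactly the two triangle relations.
  · exfalso
    have := (hφ.orient_trans (ε := -ε) hℓp hpq hqr (by rw [orient_neg]; linarith)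
      (by rw [orient_neg]; linarith)).1
    rw [orient_neg] at this
    linarith
  · exact absurd ⟨h₁, h₂⟩ hpq'
  · exact absurd ⟨by linarith, by linarith⟩ hqp'
  · exact ⟨h₁, h₂⟩

/-- Caps inside separated families of a cap of families combine to one cap. -/
lemma isTripleChain_biUnion [DecidableEq Plane] {φ : Plane → ℝ} (hφ : IsAffineForm φ) {ε : ℝ}
    {K t : ℕ} (ht : 6 * t ≤ K) {Y : ℕ → Finset Plane}
    (hlt : ∀ a b, a < b → b < K → ∀ p ∈ Y a, ∀ q ∈ Y b, φ p < φ q)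
    (htri : ∀ a b d, a < b → b < d → d < K → ∀ p ∈ Y a, ∀ q ∈ Y b, ∀ r ∈ Y d,
      0 < orient ε p q r)
    {L R : ℕ → Plane} (hL : ∀ i < t, L i ∈ Y (6 * i)) (hR : ∀ i < t, R i ∈ Y (6 * i + 5))
    {g : ℕ → ℕ} (hg : ∀ i < t, 6 * i < g i ∧ g i < 6 * i + 5)
    {C : ℕ → Finset Plane} (hC : ∀ i < t, C i ⊆ Y (g i))
    (hch : ∀ i < t, IsTripleChain φ (fun p q r => 0 < orient ε p q r) (C i))
    (hCL : ∀ i < t, ∀ p ∈ C i, ∀ q ∈ C i, φ p < φ q →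
      0 < orient ε (L i) p q ∧ 0 < orient ε p q (R i)) :
    IsTripleChain φ (fun p q r => 0 < orient ε p q r) ((Finset.range t).biUnion C) := by
  have hle : ∀ i < t, ∀ i' < t, ∀ p ∈ C i, ∀ q ∈ C i', φ p < φ q → i ≤ i' := by
    intro i hi i' hi' p hp q hq hpq
    by_contra hlt'
    have := hg i hi
    have := hg i' hi'
    exact lt_asymm hpq (hlt (g i') (g i) (by omega) (by omega) q (hC i' hi' hq) p (hC i hi hp))
  intro p hp q hq r hr hpq hqr
  simp only [Finset.mem_biUnion, Finset.mem_range] at hp hq hr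
  obtain ⟨i, hi, hp⟩ := hp
  obtain ⟨j, hj, hq⟩ := hq
  obtain ⟨k, hk, hr⟩ := hr
  have hij := hle i hi j hj p hp q hq hpq
  have hjk := hle j hj k hk q hq r hr hqr
  have gi := hg i hi
  have gj := hg j hj
  have gk := hg k hk
  -- When exactly two of the points share a family, the separating point `R i` or `L j` lies between
  -- them and the third, and transitivity passes through it.
  rcases hij.eq_or_lt with rfl | hij <;> rcases hjk.eq_or_lt with rfl | hjk
  · exact hch i hi p hp q hq r hr hpq hqr
  · exact (hφ.orient_trans hpq
      (hlt (g i) (6 * i + 5) (by omega) (by omega) q (hC i hi hq) _ (hR i hi))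
      (hlt (6 * i + 5) (g k) (by omega) (by omega) _ (hR i hi) r (hC k hk hr))
      (hCL i hi p hp q hq hpq).2
      (htri (g i) (6 * i + 5) (g k) (by omega) (by omega) (by omega) q (hC i hi hq) _ (hR i hi)
        r (hC k hk hr))).1
  · exact (hφ.orient_trans
      (hlt (g i) (6 * j) (by omega) (by omega) p (hC i hi hp) _ (hL j hj))
      (hlt (6 * j) (g j) (by omega) (by omega) _ (hL j hj) q (hC j hj hq)) hqr
      (htri (g i) (6 * j) (g j) (by omega) (by omega) (by omega) p (hC i hi hp) _ (hL j hj)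
        q (hC j hj hq))
      (hCL j hj q hq r hr hqr).1).2
  · exact htri (g i) (g j) (g k) (by omega) (by omega) (by omega) p (hC i hi hp) q (hC j hj hq)
      r (hC k hk hr)

/-! ### The exponential upper bound. -/

lemma ForcesConvex.mono {m n N : ℕ} (h : ForcesConvex n N) (hmn : m ≤ n) : ForcesConvex m N := by
  intro P hcard hP
  obtain ⟨Q, hQP, hQ, hconv⟩ := h P hcard hP
  obtain ⟨R, hRQ, hR⟩ := Finset.exists_subset_card_eq (show m ≤ Q.card by omega)
  exact ⟨R, hRQ.trans hQP, hR, hconv.mono hRQ⟩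

lemma forcesConvex_of_le_card {n N : ℕ}
    (h : ∀ P : Finset Plane, N ≤ P.card → InGeneralPosition P →
      ∃ Q ⊆ P, n ≤ Q.card ∧ InConvexPosition Q) : ForcesConvex n N := by
  intro P hcard hP
  obtain ⟨Q, hQP, hQ, hconv⟩ := h P hcard hP
  obtain ⟨R, hRQ, hR⟩ := Finset.exists_subset_card_eq hQ
  exact ⟨R, hRQ.trans hQP, hR, hconv.mono hRQ⟩

theorem exists_forcesConvex : ∃ M c : ℕ, ∀ j : ℕ,
    ForcesConvex (8 * j)
      (M * (c * ((4 * j + 8 * j).choose (4 * j) * (j + 8 * j).choose j) + 1)) := by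
  classical
  -- 48 is eight blocks of six. In block `i`, positions `6 * i` and `6 * i + 5` carry the base,
  -- while `6 * i + 1` and `6 * i + 4` are congruent to 1 modulo 3 and hence large.
  obtain ⟨M, c, hMc⟩ := exists_positive_fraction 48
  refine ⟨M, c, fun j => forcesConvex_of_le_card fun P hcard hP => ?_⟩
  set a := (4 * j + 8 * j).choose (4 * j) with ha
  set b := (j + 8 * j).choose j with hb
  obtain ⟨φ, hφ, hinj⟩ := exists_isAffineForm_injOn P
  obtain ⟨ε, hε, Y, hY, hYcard, hlt, htri⟩ := hMc P hP φ hφ hinj (c * (a * b) + 1) (by omega) hcard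
  choose! y hy using fun k (hk : k < 48) => (hY k hk).2
  have hbig : ∀ k < 48, k % 3 = 1 → a * b < (Y k).card := by
    intro k hk hk3
    have := hYcard k hk hk3
    by_contra hle
    have := Nat.mul_le_mul_left c (not_lt.mp hle)
    omega
  have hpos : ∀ i < 8, ∀ k, 6 * i < k → k < 6 * i + 5 → ∀ p ∈ Y k,
      0 < orient ε (y (6 * i)) p (y (6 * i + 5)) := by
    intro i hi k h₁ h₂ p hp
    exact htri _ _ _ h₁ h₂ (by omega) _ (hy _ (by omega)) p hp _ (hy _ (by omega))
  have mirsky : ∀ i < 8, ∀ k, 6 * i < k → k < 6 * i + 5 → k % 3 = 1 →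
      (∃ Z ⊆ Y k, a < Z.card ∧ ∀ p ∈ Z, ∀ q ∈ Z, p ≠ q →
        InTriangle ε (y (6 * i)) (y (6 * i + 5)) p q ∨
          InTriangle ε (y (6 * i)) (y (6 * i + 5)) q p) ∨
      (∃ Z ⊆ Y k, b < Z.card ∧ ∀ p ∈ Z, ∀ q ∈ Z,
        ¬ InTriangle ε (y (6 * i)) (y (6 * i + 5)) p q) := by
    intro i hi k h₁ h₂ h₃
    exact exists_chain_or_antichain (InTriangle ε (y (6 * i)) (y (6 * i + 5))) (Y k)
      (fun p hp q hq r hr => InTriangle.trans (hpos i hi k h₁ h₂ p hp) (hpos i hi k h₁ h₂ q hq)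
        (hpos i hi k h₁ h₂ r hr))
      (fun p _ => not_inTriangle_self _ _ _ p) a b (hbig k (by omega) h₃)
  -- Either some block has long triangle chains in both large families, or every block has a large
  -- family without one, which by `mirsky` contains a long antichain.
  by_cases hcase : ∃ i < 8, ∀ k, 6 * i < k → k < 6 * i + 5 → k % 3 = 1 →
      ∃ Z ⊆ Y k, a < Z.card ∧ ∀ p ∈ Z, ∀ q ∈ Z, p ≠ q →
        InTriangle ε (y (6 * i)) (y (6 * i + 5)) p q ∨
          InTriangle ε (y (6 * i)) (y (6 * i + 5)) q p
  · obtain ⟨i, hi, hch⟩ := hcase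
    obtain ⟨A, hAY, hA, hAc⟩ := hch (6 * i + 1) (by omega) (by omega) (by omega)
    obtain ⟨B, hBY, hB, hBc⟩ := hch (6 * i + 4) (by omega) (by omega) (by omega)
    refine exists_inConvexPosition_of_chains hP hε
      (hAY.trans (hY _ (by omega)).1) (hBY.trans (hY _ (by omega)).1)
      (fun p hp => hpos i hi _ (by omega) (by omega) p (hAY hp))
      (fun p hp => hpos i hi _ (by omega) (by omega) p (hBY hp))
      (fun p hp q hq => ⟨htri _ _ _ (by omega) (by omega) (by omega) _ (hy (6 * i) (by omega))
          p (hAY hp) q (hBY hq),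
        htri _ _ _ (by omega) (by omega) (by omega) p (hAY hp) q (hBY hq) _
          (hy (6 * i + 5) (by omega))⟩)
      (Finset.disjoint_left.mpr fun p hp hp' => lt_irrefl _
        (hlt _ _ (by omega) (by omega) p (hAY hp) p (hBY hp')))
      hAc hBc (h := 4 * j) (by omega) hA hB
  · push Not at hcase
    have hanti : ∀ i < 8, ∃ k, 6 * i < k ∧ k < 6 * i + 5 ∧ ∃ Z ⊆ Y k, b < Z.card ∧
        ∀ p ∈ Z, ∀ q ∈ Z, ¬ InTriangle ε (y (6 * i)) (y (6 * i + 5)) p q := by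
      intro i hi
      obtain ⟨k, h₁, h₂, h₃, hno⟩ := hcase i hi
      refine ⟨k, h₁, h₂, (mirsky i hi k h₁ h₂ h₃).resolve_left ?_⟩
      rintro ⟨Z, hZY, hZ, hZc⟩
      obtain ⟨p, hp, q, hq, hpq, n₁, n₂⟩ := hno Z hZY hZ
      exact (hZc p hp q hq hpq).elim n₁ n₂
    choose! g hg₁ hg₂ Z hZY hZcard hZ using hanti
    have hZP : ∀ i < 8, Z i ⊆ P := fun i hi =>
      (hZY i hi).trans (hY _ (by have := hg₂ i hi; omega)).1
    have neOf : ∀ {p q : Plane}, φ p < φ q → p ≠ q := fun h e => by simp [e] at h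
    have hcap : ∀ i < 8,
        (∃ C ⊆ Z i, C.card = j + 2 ∧ IsTripleChain φ (fun p q r => 0 < orient ε p q r) C) ∨
        (∃ C ⊆ Z i, C.card = 8 * j + 2 ∧
          IsTripleChain φ (fun p q r => 0 < orient (-ε) p q r) C) := by
      intro i hi
      refine exists_isTripleChain_orient hφ j (8 * j)
        (hinj.mono (by exact_mod_cast hZP i hi)) (fun p hp q hq r hr hpq hqr => ?_) (hZcard i hi)
      exact hP.orient_ne_zero hε (hZP i hi hp) (hZP i hi hq) (hZP i hi hr) (neOf hpq)
        (neOf (hpq.trans hqr)) (neOf hqr)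
    by_cases hcup : ∃ i < 8, ∃ C ⊆ Z i, C.card = 8 * j + 2 ∧
        IsTripleChain φ (fun p q r => 0 < orient (-ε) p q r) C
    · obtain ⟨i, hi, C, hCZ, hC, hch⟩ := hcup
      exact ⟨C, hCZ.trans (hZP i hi), by omega, inConvexPosition_of_isTripleChain
        (hinj.mono (by exact_mod_cast hCZ.trans (hZP i hi))) (by omega) hch⟩
    have hcap' : ∀ i < 8, ∃ C ⊆ Z i, C.card = j + 2 ∧
        IsTripleChain φ (fun p q r => 0 < orient ε p q r) C := fun i hi =>
      (hcap i hi).resolve_right fun h => hcup ⟨i, hi, h⟩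
    choose! C hCZ hCcard hCch using hcap'
    have hCP : (Finset.range 8).biUnion C ⊆ P := Finset.biUnion_subset.mpr fun i hi =>
      (hCZ i (Finset.mem_range.mp hi)).trans (hZP i (Finset.mem_range.mp hi))
    have hcardC : ((Finset.range 8).biUnion C).card = 8 * (j + 2) := by
      rw [Finset.card_biUnion]
      · rw [Finset.sum_congr rfl fun i hi => hCcard i (Finset.mem_range.mp hi)]
        simp
      · have hd : ∀ i < 8, ∀ i' < 8, i < i' → Disjoint (C i) (C i') := by
          intro i hi i' hi' hii
          refine Finset.disjoint_left.mpr fun p hp hp' => lt_irrefl (φ p) ?_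
          have := hg₂ i hi
          have := hg₁ i' hi'
          have := hg₂ i' hi'
          exact hlt (g i) (g i') (by omega) (by omega) p (hZY i hi (hCZ i hi hp)) p
            (hZY i' hi' (hCZ i' hi' hp'))
        intro i hi i' hi' hne
        rw [Finset.mem_coe, Finset.mem_range] at hi hi'
        rcases lt_or_gt_of_ne hne with h | h
        · exact hd i hi i' hi' h
        · exact (hd i' hi' i hi h).symm
    refine ⟨_, hCP, by omega, inConvexPosition_of_isTripleChain
      (hinj.mono (by exact_mod_cast hCP)) (by omega)
      (isTripleChain_biUnion hφ (le_refl (6 * 8)) hlt htri (L := fun i => y (6 * i))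
        (R := fun i => y (6 * i + 5)) (fun i hi => hy _ (by omega)) (fun i hi => hy _ (by omega))
        (fun i hi => ⟨hg₁ i hi, hg₂ i hi⟩) (fun i hi => (hCZ i hi).trans (hZY i hi)) hCch ?_)⟩
    intro i hi p hp q hq hpq
    have h₁ := hg₁ i hi
    have h₂ := hg₂ i hi
    have hpZ := hCZ i hi hp
    have hqZ := hCZ i hi hq
    have hℓ := hy (6 * i) (by omega)
    have hr := hy (6 * i + 5) (by omega)
    have hℓP := (hY (6 * i) (by omega)).1 hℓ
    have hrP := (hY (6 * i + 5) (by omega)).1 hr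
    have lℓp := hlt _ _ h₁ (by omega) _ hℓ p (hZY i hi hpZ)
    have lqr := hlt _ _ h₂ (by omega) q (hZY i hi hqZ) _ hr
    exact hφ.orient_pos_of_not_inTriangle lℓp hpq lqr (hpos i hi _ h₁ h₂ p (hZY i hi hpZ))
      (hP.orient_ne_zero hε hℓP (hZP i hi hpZ) (hZP i hi hqZ) (neOf lℓp) (neOf (lℓp.trans hpq))
        (neOf hpq))
      (hP.orient_ne_zero hε (hZP i hi hpZ) (hZP i hi hqZ) hrP (neOf hpq) (neOf (hpq.trans lqr))
        (neOf lqr))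
      (hZ i hi p hpZ q hqZ) (hZ i hi q hqZ p hpZ)

/-! ### Numerical estimates and conclusion. -/

lemma choose_mul_pow_le (x m k : ℕ) : m.choose k * x ^ (m - k) ≤ (1 + x) ^ m := by
  rcases le_or_gt k m with hk | hk
  · rw [add_pow]
    refine le_trans (le_of_eq ?_) (Finset.single_le_sum (f := fun i => 1 ^ i * x ^ (m - i) *
      (m.choose i)) (fun _ _ => Nat.zero_le _) (Finset.mem_range.mpr (Nat.lt_succ_of_le hk)))
    simp [mul_comm]
  · simp [Nat.choose_eq_zero_of_lt hk]

/-- The weights 2 and 8 are the optimal ratios `(m - k) / k` for the two binomials. The resulting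
base `3 ^ 12 * 9 ^ 9 / (2 ^ 8 * 8 ^ 8)` is just under 48000, and so below `4 ^ 8`. -/
lemma choose_mul_choose_le (j : ℕ) :
    (4 * j + 8 * j).choose (4 * j) * (j + 8 * j).choose j ≤ 48000 ^ j := by
  have h₁ := choose_mul_pow_le 2 (4 * j + 8 * j) (4 * j)
  have h₂ := choose_mul_pow_le 8 (j + 8 * j) j
  rw [Nat.add_sub_cancel_left, pow_mul] at h₁ h₂
  rw [← add_mul, pow_mul] at h₁
  rw [show j + 8 * j = 9 * j by ring, pow_mul] at h₂
  rw [← add_mul, show j + 8 * j = 9 * j by ring]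
  have h₃ := Nat.mul_le_mul h₁ h₂
  refine Nat.le_of_mul_le_mul_right (c := (2 ^ 8) ^ j * (8 ^ 8) ^ j) ?_ (by positivity)
  calc _ = ((4 + 8) * j).choose (4 * j) * (2 ^ 8) ^ j * ((9 * j).choose j * (8 ^ 8) ^ j) := by ring
    _ ≤ ((1 + 2) ^ (4 + 8)) ^ j * ((1 + 8) ^ 9) ^ j := h₃
    _ = ((1 + 2) ^ (4 + 8) * (1 + 8) ^ 9) ^ j := (mul_pow _ _ _).symm
    _ ≤ (48000 * (2 ^ 8 * 8 ^ 8)) ^ j := Nat.pow_le_pow_left (by norm_num) _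
    _ = _ := by rw [mul_pow, mul_pow]

/-- The binomial is half of the central one, `Nat.centralBinom (n - 2)`. -/
lemma four_pow_le_mul_choose {n : ℕ} (hn : 3 ≤ n) :
    4 ^ (n - 2) ≤ 4 * n * (2 * n - 5).choose (n - 2) := by
  obtain ⟨m, rfl⟩ := Nat.exists_eq_add_of_le' hn
  have h := Nat.four_pow_le_two_mul_self_mul_centralBinom (m + 1) (by omega)
  have e : Nat.centralBinom (m + 1) = 2 * (2 * m + 1).choose (m + 1) := by
    rw [Nat.centralBinom_eq_two_mul_choose, show 2 * (m + 1) = (2 * m + 1) + 1 by ring,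
      Nat.choose_succ_succ, Nat.choose_symm_half]
    ring
  rw [e] at h
  rw [show m + 3 - 2 = m + 1 by omega, show 2 * (m + 3) - 5 = 2 * m + 1 by omega]
  refine h.trans ?_
  rw [← mul_assoc]
  exact Nat.mul_le_mul_right _ (by omega)

lemma ES_le {n N : ℕ} (h : ForcesConvex n N) : ES n ≤ N :=
  iInf₂_le N h

lemma eventually_mul_pow_le (D : ℕ) :
    ∀ᶠ j : ℕ in Filter.atTop, D * (j * 48000 ^ j) ≤ 65536 ^ j := by
  have h := (tendsto_self_mul_const_pow_of_lt_one (r := (48000 / 65536 : ℝ)) (by norm_num)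
    (by norm_num)).const_mul (D : ℝ)
  rw [mul_zero] at h
  filter_upwards [h.eventually (gt_mem_nhds one_pos)] with j hj
  rw [div_pow, ← mul_div_assoc, ← mul_div_assoc, div_lt_one (by positivity)] at hj
  exact_mod_cast hj.le

theorem theorem1 :
    Filter.limsup
      (fun n : ℕ => ((ES n : ENNReal) / ((Nat.choose (2 * n - 5) (n - 2) : ℕ) : ENNReal)))
      Filter.atTop ≤ (7 / 8 : ENNReal) := by
  obtain ⟨M, c, hMc⟩ := exists_forcesConvex
  have htend : Filter.Tendsto (fun n : ℕ => n / 8 + 1) Filter.atTop Filter.atTop :=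
    Filter.tendsto_atTop_mono (fun n => Nat.le_succ _)
      (Nat.tendsto_div_const_atTop (n := 8) (by norm_num))
  refine Filter.limsup_le_of_le (h := ?_)
  filter_upwards [htend.eventually (eventually_mul_pow_le (2 * M * (c + 1) * 32 * 4 ^ 10)),
    Filter.eventually_ge_atTop 3] with n hev hn
  -- This choice gives `n ≤ 8 * j ≤ (n - 2) + 10`; the second inequality is the source of the factor
  -- `4 ^ 10`.
  set j := n / 8 + 1 with hj
  set N := M * (c * ((4 * j + 8 * j).choose (4 * j) * (j + 8 * j).choose j) + 1) with hN
  have hES : ES n ≤ N := ES_le ((hMc j).mono (by omega))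
  have hNle : N ≤ M * (c + 1) * 48000 ^ j := by
    rw [hN, mul_assoc]
    refine Nat.mul_le_mul_left _ ?_
    have := Nat.mul_le_mul_left c (choose_mul_choose_le j)
    have : 0 < 48000 ^ j := by positivity
    nlinarith
  have hmain : 2 * N ≤ (2 * n - 5).choose (n - 2) := by
    have h4 : 4 ^ (8 * j) ≤ 4 ^ 10 * 4 ^ (n - 2) := by
      rw [← pow_add]; exact Nat.pow_le_pow_right (by norm_num) (by omega)
    have h65 : (65536 : ℕ) ^ j = 4 ^ (8 * j) := by rw [pow_mul]; norm_num
    have hc := four_pow_le_mul_choose hn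
    have hn8 : 4 * n * (2 * n - 5).choose (n - 2) ≤ 32 * j * (2 * n - 5).choose (n - 2) :=
      Nat.mul_le_mul_right _ (by omega)
    have hj0 : 0 < 4 ^ 10 * (32 * j) := by positivity
    refine le_of_mul_le_mul_left ?_ hj0
    calc 4 ^ 10 * (32 * j) * (2 * N)
        ≤ 4 ^ 10 * (32 * j) * (2 * (M * (c + 1) * 48000 ^ j)) := by gcongr
      _ = 2 * M * (c + 1) * 32 * 4 ^ 10 * (j * 48000 ^ j) := by ring
      _ ≤ 65536 ^ j := hev
      _ ≤ 4 ^ 10 * 4 ^ (n - 2) := h65 ▸ h4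
      _ ≤ 4 ^ 10 * (32 * j * (2 * n - 5).choose (n - 2)) := Nat.mul_le_mul_left _ (hc.trans hn8)
      _ = 4 ^ 10 * (32 * j) * (2 * n - 5).choose (n - 2) := by ring
  have h8 : 8 * N ≤ 7 * (2 * n - 5).choose (n - 2) := by omega
  refine ENNReal.div_le_of_le_mul ?_
  have hES' : (ES n : ENNReal) ≤ (N : ENNReal) := by exact_mod_cast ENat.toENNReal_le.mpr hES
  refine hES'.trans ?_
  rw [ENNReal.div_eq_inv_mul, mul_assoc, ← ENNReal.div_eq_inv_mul,
    ENNReal.le_div_iff_mul_le (by simp) (by simp), mul_comm]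
  exact_mod_cast h8
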